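/- For a topological space $X$ and an ordinal $\alpha$ (with its order topology), write $X \to (\mathrm{top}\,\alpha)^1_\omega$ if for every colouring $f : X \to \omega$ there are a colour $n \in \omega$ and a subset $Y \subseteq f^{-1}(\{n\})$ which, as a subspace of $X$, is homeomorphic to $\alpha$. Let $\chi(X)$ be the character of $X$, i.e. the supremum over $x \in X$ of the least cardinality of a local base of $X$ at $x$, and let $\mathfrak b$ be the bounding number, i.e. the least cardinality of a family $F \subseteq \omega^\omega$ for which there is no $g \in \omega^\omega$ such that every $f \in F$ satisfies $f(n) \le g(n)$ for all but finitely many $n$. Theorem. Let $X$ be a regular topological space (no separation axiom beyond regularity is needed) with $\chi(X) < \mathfrak b$. If $X \to (\mathrm{top}\,(\omega+1))^1_\omega$, then $X \to (\mathrm{top}\,\alpha)^1_\omega$ for every ordinal $\alpha < \omega_1$. -/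

import Mathlib

open scoped Cardinal Ordinal Topology

universe u v w

/-- `B` is a local base of the space at `x`: a family of open neighbourhoods of `x` such that every
neighbourhood of `x` contains a member of the family. -/
def IsLocalBase {X : Type u} [TopologicalSpace X] (x : X) (B : Set (Set X)) : Prop :=
  (∀ U ∈ B, IsOpen U ∧ x ∈ U) ∧ ∀ V ∈ 𝓝 x, ∃ U ∈ B, U ⊆ V

/-- The character `χ(x, X)` of a point: the least cardinality of a local base at `x`. -/
noncomputable def pointCharacter {X : Type u} [TopologicalSpace X] (x : X) : Cardinal.{u} :=
  sInf {κ : Cardinal.{u} | ∃ B : Set (Set X), IsLocalBase x B ∧ #B = κ}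

/-- The character `χ(X)` of a space: the supremum of the characters of its points. The family is
indexed by `X : Type u`, hence bounded in `Cardinal.{u}`. -/
noncomputable def character (X : Type u) [TopologicalSpace X] : Cardinal.{u} :=
  ⨆ x : X, pointCharacter x

/-- A family of functions `ℕ → ℕ` is unbounded if no single function eventually dominates all of
its members. -/
def IsUnboundedFamily (F : Set (ℕ → ℕ)) : Prop :=
  ¬ ∃ g : ℕ → ℕ, ∀ f ∈ F, ∀ᶠ n in Filter.atTop, f n ≤ g n

/-- The bounding number `𝔟`: the least cardinality of an unbounded family. -/
noncomputable def boundingNumber : Cardinal.{0} :=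
  sInf {κ : Cardinal.{0} | ∃ F : Set (ℕ → ℕ), IsUnboundedFamily F ∧ #F = κ}

/-- The partition relation `X → (top α)¹_C`: for every colouring of the points of `X` with colours
in `C`, some colour class has a subset homeomorphic to the ordinal `α`, that is, to the
set `Set.Iio α` of its predecessors (whose subspace topology is its order topology). -/
def TopArrow (X : Type u) [TopologicalSpace X] (α : Ordinal.{v}) (C : Type w) : Prop :=
  ∀ f : X → C, ∃ (η : C) (Y : Set X), Y ⊆ f ⁻¹' {η} ∧ Nonempty (Y ≃ₜ Set.Iio α)

open Filter Set

/-- Every point of a space `X` has a local base of cardinality at most `χ(X)`. -/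
theorem exists_isLocalBase_mk_le_character {X : Type u} [TopologicalSpace X] (x : X) :
    ∃ B : Set (Set X), IsLocalBase x B ∧ #B ≤ character X := by
  have hne : {κ : Cardinal.{u} | ∃ B : Set (Set X), IsLocalBase x B ∧ #B = κ}.Nonempty := by
    refine ⟨_, {U | IsOpen U ∧ x ∈ U}, ⟨fun U hU => hU, fun V hV => ?_⟩, rfl⟩
    obtain ⟨U, hUV, hU, hx⟩ := mem_nhds_iff.1 hV
    exact ⟨U, ⟨hU, hx⟩, hUV⟩
  obtain ⟨B, hB, hcard⟩ := csInf_mem hne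
  exact ⟨B, hB, hcard.trans_le
    (le_ciSup (f := fun x : X => pointCharacter x) Cardinal.bddAbove_of_small x)⟩

/-- A family of fewer than `𝔟` functions is eventually dominated by a single function. -/
theorem exists_eventually_le_of_mk_lt_boundingNumber {ι : Type u}
    (hι : #ι < Cardinal.lift.{u} boundingNumber) (F : ι → ℕ → ℕ) :
    ∃ g : ℕ → ℕ, ∀ i, ∀ᶠ n in atTop, F i n ≤ g n := by
  by_contra hg
  have hF : IsUnboundedFamily (range F) := by
    rintro ⟨g, h⟩
    exact hg ⟨g, fun i => h _ ⟨i, rfl⟩⟩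
  have hle : boundingNumber ≤ #(range F) := csInf_le' ⟨_, hF, rfl⟩
  have hrange : Cardinal.lift.{u} #(range F) ≤ Cardinal.lift.{0} #ι := Cardinal.mk_range_le_lift
  rw [Cardinal.lift_id'.{0, u}] at hrange
  exact (((Cardinal.lift_le.2 hle).trans hrange).trans_lt hι).false

/-- Diagonalisation at a point of character less than `𝔟`: if each neighbourhood of `x` contains,
for almost all `k`, some member of the decreasing sequence `T k`, then one choice of members
converges to `x`. -/
theorem exists_diagonal_subset_nhds {X : Type u} [TopologicalSpace X]
    (hχ : character X < Cardinal.lift.{u} boundingNumber) (x : X) (T : ℕ → ℕ → Set X)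
    (hT : ∀ k, Antitone (T k)) (h : ∀ V ∈ 𝓝 x, ∀ᶠ k in atTop, ∃ m, T k m ⊆ V) :
    ∃ g : ℕ → ℕ, ∀ V ∈ 𝓝 x, ∀ᶠ k in atTop, T k (g k) ⊆ V := by
  classical
  obtain ⟨B, hB, hcard⟩ := exists_isLocalBase_mk_le_character x
  obtain ⟨g, hg⟩ := exists_eventually_le_of_mk_lt_boundingNumber (hcard.trans_lt hχ)
    (fun (V : B) k => if hk : ∃ m, T k m ⊆ V then hk.choose else 0)
  refine ⟨g, fun V hV => ?_⟩
  obtain ⟨U, hU, hUV⟩ := hB.2 V hV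
  filter_upwards [hg ⟨U, hU⟩, h U ((hB.1 U hU).1.mem_nhds (hB.1 U hU).2)] with k hk hex
  rw [dif_pos hex] at hk
  exact ((hT k hk).trans hex.choose_spec).trans hUV

/-- Dependent choice of a sequence whose `n`-th term is constrained by all the previous ones. -/
theorem exists_seq_of_forall_fin_exists {β : Type*} (P : ℕ → β → Prop) (r : β → β → Prop)
    (h : ∀ n (f : Fin n → β), (∀ i : Fin n, P i (f i)) → ∃ y, P n y ∧ ∀ i, r (f i) y) :
    ∃ f : ℕ → β, (∀ n, P n (f n)) ∧ ∀ m n, m < n → r (f m) (f n) := by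
  let F : ∀ n, (∀ m < n, {y // P m y}) → {y // P n y} := fun n ih =>
    ⟨(h n (fun i : Fin n => (ih i i.2).1) (fun i : Fin n => (ih i i.2).2)).choose,
      (h n (fun i : Fin n => (ih i i.2).1) (fun i : Fin n => (ih i i.2).2)).choose_spec.1⟩
  let f : ∀ n, {y // P n y} := fun n => Nat.strongRec F n
  have hf : ∀ n, f n = F n (fun m _ => f m) := fun n => by
    simp only [f]
    rw [Nat.strongRec]
  refine ⟨fun n => (f n).1, fun n => (f n).2, fun m n hmn => ?_⟩
  have := (h n (fun i : Fin n => (f i).1) (fun i : Fin n => (f i).2)).choose_spec.2 ⟨m, hmn⟩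
  change r (f m).1 (f n).1
  rw [hf n]
  exact this

/-- `SeqRank A α x` says that `x` survives `α` steps of the sequential Cantor–Bendixson process
on `A`: it lies in `A` and, for each `γ < α`, it is the limit of a sequence of points,
topologically distinguishable from `x`, which survive `γ` steps. -/
inductive SeqRank {X : Type u} [TopologicalSpace X] (A : Set X) : Ordinal.{0} → X → Prop
  | intro (α : Ordinal.{0}) (x : X) (hx : x ∈ A) (s : Ordinal.{0} → ℕ → X)
      (hne : ∀ γ < α, ∀ k, ¬ Inseparable (s γ k) x)
      (hlim : ∀ γ < α, Tendsto (s γ) atTop (𝓝 x))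
      (hs : ∀ γ < α, ∀ k, SeqRank A γ (s γ k)) : SeqRank A α x

/-- `EmbedsIic α S`: there is a continuous map of `[0, α]` into `S` that takes distinct ordinals to
topologically distinguishable points. -/
def EmbedsIic {X : Type u} [TopologicalSpace X] (α : Ordinal.{0}) (S : Set X) : Prop :=
  ∃ e : Ordinal.{0} → X, ContinuousOn e (Iic α) ∧ MapsTo e (Iic α) S ∧
    ∀ ξ ≤ α, ∀ η ≤ α, Inseparable (e ξ) (e η) → ξ = η

/-- Copies of `[0, γ k]` inside pairwise disjoint open sets that shrink to `x` can be glued, with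
`x` on top, to a copy of `[0, α]` if every `ξ < α` is below some `γ k`. -/
theorem embedsIic_insert_iUnion {X : Type u} [TopologicalSpace X] {α : Ordinal.{0}} {x : X}
    {γ : ℕ → Ordinal.{0}} (hγ : ∀ k, γ k < α) (hcof : ∀ ξ < α, ∃ k, ξ ≤ γ k)
    {Z W : ℕ → Set X} (hZW : ∀ k, Z k ⊆ W k) (hW : ∀ k, IsOpen (W k)) (hxW : ∀ k, x ∉ W k)
    (hdisj : ∀ i j, i ≠ j → Disjoint (W i) (W j))
    (hlim : ∀ V ∈ 𝓝 x, ∀ᶠ k in atTop, Z k ⊆ V) (hZ : ∀ k, EmbedsIic (γ k) (Z k)) :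
    EmbedsIic α (insert x (⋃ k, Z k)) := by
  classical
  choose e hcont hmaps hinj using hZ
  let κ : Ordinal.{0} → ℕ := fun ξ => if h : ∃ k, ξ ≤ γ k then Nat.find h else 0
  have hκ : ∀ ξ < α, ξ ≤ γ (κ ξ) := fun ξ hξ => by
    simp only [κ, dif_pos (hcof ξ hξ)]
    exact Nat.find_spec (hcof ξ hξ)
  have hκmin : ∀ ξ k, k < κ ξ → γ k < ξ := fun ξ k hk => by
    by_cases h : ∃ k, ξ ≤ γ k
    · simp only [κ, dif_pos h] at hk
      exact not_le.1 (Nat.find_min h hk)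
    · exact not_le.1 fun hle => h ⟨k, hle⟩
  have hκeq : ∀ ξ k, ξ ≤ γ k → (∀ j < k, γ j < ξ) → κ ξ = k := fun ξ k hk hj => by
    rcases lt_trichotomy (κ ξ) k with h | h | h
    · exact absurd (hκ ξ (hk.trans_lt (hγ k))) (not_le.2 (hj _ h))
    · exact h
    · exact absurd hk (not_le.2 (hκmin ξ k h))
  let E : Ordinal.{0} → X := fun ξ => if ξ < α then e (κ ξ) ξ else x
  have hElt : ∀ ξ, ξ < α → E ξ = e (κ ξ) ξ := fun ξ hξ => if_pos hξ
  have hEα : E α = x := if_neg (lt_irrefl α)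
  have hEZ : ∀ ξ, ξ < α → E ξ ∈ Z (κ ξ) := fun ξ hξ => by
    rw [hElt ξ hξ]
    exact hmaps _ (hκ ξ hξ)
  have hopen : ∀ k, IsOpen {ξ : Ordinal.{0} | ∀ j < k, γ j < ξ} := fun k => by
    have : {ξ : Ordinal.{0} | ∀ j < k, γ j < ξ} = ⋂ j ∈ Iio k, Ioi (γ j) := by
      ext ξ
      simp
    rw [this]
    exact (finite_Iio k).isOpen_biInter fun _ _ => isOpen_Ioi
  refine ⟨E, ?_, ?_, ?_⟩
  · intro ξ hξ
    rcases (mem_Iic.1 hξ).lt_or_eq with hlt | rfl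
    · set k := κ ξ with hk
      have hnhds : {η : Ordinal.{0} | ∀ j < k, γ j < η} ∩ Iio (Order.succ (γ k)) ∈ 𝓝 ξ :=
        ((hopen k).inter isOpen_Iio).mem_nhds
          ⟨fun j hj => hκmin ξ j hj, Order.lt_succ_iff.2 (hκ ξ hlt)⟩
      have heq : ∀ η ∈ {η : Ordinal.{0} | ∀ j < k, γ j < η} ∩ Iio (Order.succ (γ k)),
          E η = e k η := fun η hη => by
        have hle : η ≤ γ k := Order.lt_succ_iff.1 hη.2
        rw [hElt η (hle.trans_lt (hγ k)), hκeq η k hle hη.1]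
      have hat : ContinuousAt (e k) ξ := by
        refine (hcont k ξ (hκ ξ hlt)).continuousAt ?_
        exact mem_of_superset hnhds fun η hη => mem_Iic.2 (Order.lt_succ_iff.1 hη.2)
      refine (hat.congr ?_).continuousWithinAt
      filter_upwards [hnhds] with η hη using (heq η hη).symm
    · refine tendsto_def.2 fun V hV => ?_
      rw [hEα] at hV
      obtain ⟨N, hN⟩ := eventually_atTop.1 (hlim V hV)
      have hnhds : {η : Ordinal.{0} | ∀ j < N, γ j < η} ∈ 𝓝 ξ :=
        (hopen N).mem_nhds fun j _ => hγ j
      filter_upwards [mem_nhdsWithin_of_mem_nhds hnhds, self_mem_nhdsWithin] with η hη hηξ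
      rcases (mem_Iic.1 hηξ).lt_or_eq with hlt | rfl
      · refine hN (κ η) (not_lt.1 fun h => ?_) (hEZ η hlt)
        exact absurd (hκ η hlt) (not_le.2 (hη _ h))
      · rw [mem_preimage, hEα]
        exact mem_of_mem_nhds hV
  · intro ξ hξ
    rcases (mem_Iic.1 hξ).lt_or_eq with hlt | rfl
    · exact Or.inr (mem_iUnion.2 ⟨_, hEZ ξ hlt⟩)
    · exact Or.inl hEα
  · intro ξ hξ η hη hins
    rcases hξ.lt_or_eq with hξ' | rfl <;> rcases hη.lt_or_eq with hη' | rfl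
    · have h₁ : E ξ ∈ W (κ ξ) := hZW _ (hEZ ξ hξ')
      have h₂ : E η ∈ W (κ η) := hZW _ (hEZ η hη')
      have h₃ : E η ∈ W (κ ξ) := (hins.mem_open_iff (hW _)).1 h₁
      have heq : κ ξ = κ η := by
        by_contra hne
        exact disjoint_left.1 (hdisj _ _ hne) h₃ h₂
      rw [hElt ξ hξ', hElt η hη', ← heq] at hins
      exact hinj _ ξ (hκ ξ hξ') η (heq ▸ hκ η hη') hins
    · rw [hEα] at hins
      exact absurd ((hins.mem_open_iff (hW _)).1 (hZW _ (hEZ ξ hξ'))) (hxW _)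
    · rw [hEα] at hins
      exact absurd ((hins.mem_open_iff (hW _)).2 (hZW _ (hEZ η hη'))) (hxW _)
    · rfl

theorem countable_Iio_of_lt_omega_one {α : Ordinal.{0}} (hα : α < ω₁) : Countable (Iio α) := by
  rw [← Cardinal.mk_le_aleph0_iff, Cardinal.mk_Iio_ordinal, Cardinal.lift_le_aleph0,
    ← Cardinal.lt_aleph_one_iff]
  exact Cardinal.lt_omega_iff_card_lt.1 hα

/-- A nonzero countable ordinal is the limit of an enumeration in which every smaller ordinal is
exceeded infinitely often. -/
theorem exists_seq_frequently_cofinal {α : Ordinal.{0}} (hα : α < ω₁) (h0 : α ≠ 0) :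
    ∃ γ : ℕ → Ordinal.{0}, (∀ k, γ k < α) ∧ ∀ ξ < α, ∀ N, ∃ k, ξ ≤ γ (k + N) := by
  have : Countable (Iio α) := countable_Iio_of_lt_omega_one hα
  have : Nonempty (Iio α) := ⟨⟨0, pos_iff_ne_zero.2 h0⟩⟩
  obtain ⟨s, hs⟩ := exists_surjective_nat (Iio α)
  refine ⟨fun k => (s k.unpair.1).1, fun k => (s k.unpair.1).2, fun ξ hξ N => ?_⟩
  obtain ⟨i, hi⟩ := hs ⟨ξ, hξ⟩
  refine ⟨Nat.pair i N - N, ?_⟩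
  simp only [Nat.sub_add_cancel (Nat.right_le_pair i N), Nat.unpair_pair, hi, le_refl]

/-- Countably many sequences converging to a point `x` of character less than `𝔟` have a
convergent diagonal, which moreover can be separated by pairwise disjoint open sets whose
complements are neighbourhoods of `x`. -/
theorem exists_diagonal_disjoint_nhds {X : Type u} [TopologicalSpace X] [R1Space X]
    (hχ : character X < Cardinal.lift.{u} boundingNumber) {x : X} (s : ℕ → ℕ → X)
    (hne : ∀ k m, ¬ Inseparable (s k m) x) (hlim : ∀ k, Tendsto (s k) atTop (𝓝 x)) :
    ∃ (m : ℕ → ℕ) (W : ℕ → Set X), (∀ k, IsOpen (W k)) ∧ (∀ k, s k (m k) ∈ W k) ∧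
      (∀ k, (W k)ᶜ ∈ 𝓝 x) ∧ (∀ i j, i ≠ j → Disjoint (W i) (W j)) ∧
      Tendsto (fun k => s k (m k)) atTop (𝓝 x) := by
  obtain ⟨g, hg⟩ := exists_diagonal_subset_nhds hχ x (fun k m => s k '' Ici m)
    (fun k i j hij => image_mono (Ici_subset_Ici.2 hij)) (fun V hV => Eventually.of_forall fun k => by
      obtain ⟨N, hN⟩ := eventually_atTop.1 (hlim k hV)
      exact ⟨N, image_subset_iff.2 hN⟩)
  obtain ⟨f, hf, hr⟩ := exists_seq_of_forall_fin_exists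
    (fun k (p : ℕ × Set X) => g k ≤ p.1 ∧ IsOpen p.2 ∧ s k p.1 ∈ p.2 ∧ p.2ᶜ ∈ 𝓝 x)
    (fun p q => Disjoint p.2 q.2) (by
      intro n f hf
      have hV : (⋂ i, interior (f i).2ᶜ) ∈ 𝓝 x :=
        iInter_mem.2 fun i => interior_mem_nhds.2 (hf i).2.2.2
      obtain ⟨m, hm, hgm⟩ := (((hlim n).eventually_mem hV).and (eventually_ge_atTop (g n))).exists
      obtain ⟨U, V, hU, hVo, hmU, hxV, hUV⟩ :=
        r1_separation (hne n m)
      refine ⟨(m, U ∩ ⋂ i, interior (f i).2ᶜ), ⟨hgm,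
        hU.inter (isOpen_iInter_of_finite fun _ => isOpen_interior), ⟨hmU, hm⟩, ?_⟩, fun i => ?_⟩
      · exact mem_of_superset (hVo.mem_nhds hxV) fun y hy hyU => disjoint_left.1 hUV hyU.1 hy
      · exact disjoint_left.2 fun y hy hyU => interior_subset (mem_iInter.1 hyU.2 i) hy)
  refine ⟨fun k => (f k).1, fun k => (f k).2, fun k => (hf k).2.1, fun k => (hf k).2.2.1,
    fun k => (hf k).2.2.2, fun i j hij => ?_, tendsto_def.2 fun V hV => ?_⟩
  · rcases hij.lt_or_gt with h | h
    · exact hr i j h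
    · exact (hr j i h).symm
  · filter_upwards [hg V hV] with k hk using hk ⟨_, (hf k).1, rfl⟩

/-- Around a point of rank `α < ω₁` there is a subset of `A`, first countable at that point, each of
whose neighbourhoods of the point contains a copy of `[0, α]`. -/
theorem SeqRank.exists_embedsIic {X : Type u} [TopologicalSpace X] [R1Space X]
    (hχ : character X < Cardinal.lift.{u} boundingNumber) {A : Set X} {α : Ordinal.{0}} {x : X}
    (h : SeqRank A α x) (hα : α < ω₁) :
    ∃ Y ⊆ A, x ∈ Y ∧ (𝓝[Y] x).IsCountablyGenerated ∧ ∀ S ∈ 𝓝[Y] x, EmbedsIic α S := by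
  induction h with
  | intro α x hx s hne hlim hs ih =>
  rcases eq_or_ne α 0 with rfl | h0
  · refine ⟨{x}, singleton_subset_iff.2 hx, rfl, ?_, fun S hS => ⟨fun _ => x, continuousOn_const,
      fun _ _ => mem_of_mem_nhdsWithin (mem_singleton x) hS, fun ξ hξ η hη _ => ?_⟩⟩
    · rw [nhdsWithin_singleton]
      infer_instance
    · rw [nonpos_iff_eq_zero.1 hξ, nonpos_iff_eq_zero.1 hη]
  obtain ⟨γ, hγ, hcof⟩ := exists_seq_frequently_cofinal hα h0
  obtain ⟨m, W, hWo, hmW, hxW, hdisj, hm⟩ := exists_diagonal_disjoint_nhds hχ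
    (fun k => s (γ k)) (fun k => hne _ (hγ k)) (fun k => hlim _ (hγ k))
  choose Y hYA hxY hYgen hY using fun k => ih (γ k) (hγ k) (m k) ((hγ k).trans hα)
  choose b hb using fun k => (𝓝[Y k] (s (γ k) (m k))).exists_antitone_basis
  let T : ℕ → ℕ → Set X := fun k j => b k j ∩ (Y k ∩ W k)
  have hTmem : ∀ k j, T k j ∈ 𝓝[Y k] (s (γ k) (m k)) := fun k j =>
    inter_mem ((hb k).mem j) (inter_mem self_mem_nhdsWithin
      (mem_nhdsWithin_of_mem_nhds ((hWo k).mem_nhds (hmW k))))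
  obtain ⟨g, hg⟩ := exists_diagonal_subset_nhds hχ x T
    (fun k i j hij => inter_subset_inter_left _ ((hb k).antitone hij)) (fun V hV => by
      filter_upwards [hm (interior_mem_nhds.2 hV)] with k hk
      obtain ⟨j, hj⟩ := (hb k).mem_iff.1
        (mem_nhdsWithin_of_mem_nhds (mem_interior_iff_mem_nhds.1 hk))
      exact ⟨j, inter_subset_left.trans hj⟩)
  let Z : ℕ → Set X := fun k => T k (g k)
  have hZW : ∀ k, Z k ⊆ W k := fun k y hy => hy.2.2
  have hbasis : (𝓝[insert x (⋃ k, Z k)] x).HasBasis (fun _ : ℕ => True)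
      (fun N => insert x (⋃ k, Z (k + N))) := by
    refine ⟨fun S => ⟨fun hS => ?_, fun ⟨N, _, hN⟩ => mem_of_superset ?_ hN⟩⟩
    · obtain ⟨V, hV, hVS⟩ := mem_nhdsWithin_iff_exists_mem_nhds_inter.1 hS
      obtain ⟨N, hN⟩ := eventually_atTop.1 (hg V hV)
      refine ⟨N, trivial, insert_subset
        (hVS ⟨mem_of_mem_nhds hV, mem_insert _ _⟩) (iUnion_subset fun k y hy => ?_)⟩
      exact hVS ⟨hN (k + N) (Nat.le_add_left N k) hy, Or.inr (mem_iUnion.2 ⟨_, hy⟩)⟩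
    · refine mem_nhdsWithin_iff_exists_mem_nhds_inter.2
        ⟨⋂ k ∈ Iio N, (W k)ᶜ, (biInter_mem (finite_Iio N)).2 fun k _ => hxW k, ?_⟩
      rintro y ⟨hyW, rfl | hy⟩
      · exact mem_insert _ _
      · obtain ⟨k, hk⟩ := mem_iUnion.1 hy
        have hNk : N ≤ k := not_lt.1 fun hlt => mem_iInter₂.1 hyW k hlt (hZW k hk)
        refine Or.inr (mem_iUnion.2 ⟨k - N, ?_⟩)
        rwa [Nat.sub_add_cancel hNk]
  refine ⟨insert x (⋃ k, Z k), insert_subset hx (iUnion_subset fun k y hy => hYA k hy.2.1),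
    mem_insert _ _, hbasis.isCountablyGenerated, fun S hS => ?_⟩
  obtain ⟨N, -, hN⟩ := hbasis.mem_iff.1 hS
  obtain ⟨e, hcont, hmaps, hinj⟩ := embedsIic_insert_iUnion (x := x) (γ := fun k => γ (k + N))
    (fun k => hγ _) (fun ξ hξ => hcof ξ hξ N) (Z := fun k => Z (k + N))
    (W := fun k => W (k + N)) (fun k => hZW _) (fun k => hWo _)
    (fun k hk => mem_of_mem_nhds (hxW _) hk)
    (fun i j hij => hdisj _ _ (fun h => hij (Nat.add_right_cancel h)))
    (fun V hV => (tendsto_add_atTop_nat N).eventually (hg V hV))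
    (fun k => hY _ _ (hTmem _ _))
  exact ⟨e, hcont, hmaps.mono_right hN, hinj⟩

/-- A set into which `[0, α]` embeds contains a homeomorphic copy of `α`. -/
theorem EmbedsIic.exists_homeomorph_Iio {X : Type u} [TopologicalSpace X] [R1Space X]
    {α : Ordinal.{0}} {S : Set X} (h : EmbedsIic α S) :
    ∃ Y ⊆ S, Nonempty (Y ≃ₜ Iio α) := by
  obtain ⟨e, hcont, hmaps, hinj⟩ := h
  have hcompact : CompactSpace (Iic α) := isCompact_iff_compactSpace.1 <| by
    rw [← Icc_bot]
    exact isCompact_Icc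
  have hc : Continuous fun ξ : Iic α => e ξ := continuousOn_iff_continuous_domRestrict.1 hcont
  have hq : Topology.IsEmbedding (SeparationQuotient.mk ∘ fun ξ : Iic α => e ξ) :=
    ((SeparationQuotient.continuous_mk.comp hc).isClosedEmbedding fun ξ η hξη =>
      Subtype.ext (hinj ξ ξ.2 η η.2 (SeparationQuotient.mk_eq_mk.1 hξη))).isEmbedding
  have he : Topology.IsEmbedding fun ξ : Iic α => e ξ :=
    Topology.IsEmbedding.of_comp hc SeparationQuotient.continuous_mk hq
  have he' := he.comp (Topology.IsEmbedding.inclusion (Iio_subset_Iic_self (a := α)))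
  refine ⟨_, ?_, ⟨he'.toHomeomorph.symm⟩⟩
  rintro _ ⟨ξ, rfl⟩
  exact hmaps (Iio_subset_Iic_self ξ.2)

/-- A homeomorphic copy of `ω + 1` contains a sequence converging to a point of it, all of whose
terms are topologically distinguishable from that point. -/
theorem exists_seq_of_homeomorph_Iio_omega_add_one {X : Type u} [TopologicalSpace X] {Y : Set X}
    (h : Y ≃ₜ Iio (ω + 1 : Ordinal.{0})) :
    ∃ x ∈ Y, ∃ s : ℕ → X, (∀ k, s k ∈ Y) ∧ (∀ k, ¬ Inseparable (s k) x) ∧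
      Tendsto s atTop (𝓝 x) := by
  have hω : ω < (ω + 1 : Ordinal.{0}) := Order.lt_add_one_iff.2 le_rfl
  let n : ℕ → Iio (ω + 1 : Ordinal.{0}) := fun k => ⟨k, (Ordinal.natCast_lt_omega0 k).trans hω⟩
  have hn : Tendsto n atTop (𝓝 ⟨ω, hω⟩) := by
    rw [tendsto_subtype_rng]
    refine tendsto_order.2 ⟨fun a ha => ?_, fun a ha => Eventually.of_forall fun k =>
      (Ordinal.natCast_lt_omega0 k).trans ha⟩
    obtain ⟨N, rfl⟩ := Ordinal.lt_omega0.1 ha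
    filter_upwards [eventually_gt_atTop N] with k hk
    exact Nat.cast_lt.2 hk
  have hT0 : T0Space Y := h.isEmbedding.t0Space
  refine ⟨h.symm ⟨ω, hω⟩, (h.symm _).2, fun k => h.symm (n k), fun k => (h.symm _).2,
    fun k hk => ?_, ?_⟩
  · have := h.symm.injective (Topology.IsInducing.subtypeVal.inseparable_iff.1 hk).eq
    exact (Ordinal.natCast_lt_omega0 k).ne (congrArg Subtype.val this)
  · exact (continuous_subtype_val.tendsto _).comp ((h.symm.continuous.tendsto _).comp hn)

/-- If `X → (top (ω + 1))¹_ω`, then some colour class of any colouring with countably many colours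
has points of any prescribed countable rank. -/
theorem TopArrow.exists_seqRank {X : Type u} [TopologicalSpace X]
    (hX : TopArrow X (ω + 1 : Ordinal.{0}) ℕ) (f : X → ℕ) {α : Ordinal.{0}} (hα : α < ω₁) :
    ∃ (n : ℕ) (x : X), SeqRank (f ⁻¹' {n}) α x := by
  by_contra hcon
  push Not at hcon
  let L : Ordinal.{0} → X → Prop := fun γ x => ∃ s : ℕ → X, (∀ k, ¬ Inseparable (s k) x) ∧
    Tendsto s atTop (𝓝 x) ∧ ∀ k, SeqRank (f ⁻¹' {f x}) γ (s k)
  have hrank : ∀ x β, (∀ γ < β, L γ x) → SeqRank (f ⁻¹' {f x}) β x := fun x β hβ => by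
    have : Nonempty X := ⟨x⟩
    choose! s h₁ h₂ h₃ using hβ
    exact SeqRank.intro β x rfl s h₁ h₂ h₃
  have hleast : ∀ x, ∃ γ : Iio α, ¬ L γ x ∧ SeqRank (f ⁻¹' {f x}) γ x := fun x => by
    have hne : ∃ γ, γ < α ∧ ¬ L γ x := by
      by_contra hall
      push Not at hall
      exact hcon _ x (hrank x α hall)
    obtain ⟨γ, ⟨hγ, hL⟩, hmin⟩ := WellFounded.has_min (wellFounded_lt (α := Ordinal.{0}))
      {γ | γ < α ∧ ¬ L γ x} hne
    refine ⟨⟨γ, hγ⟩, hL, hrank x γ fun δ hδ => ?_⟩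
    by_contra hLδ
    exact hmin δ ⟨hδ.trans hγ, hLδ⟩ hδ
  choose c hcL hcR using hleast
  have : Countable (Iio α) := countable_Iio_of_lt_omega_one hα
  obtain ⟨φ, hφ⟩ := exists_injective_nat (ℕ × Iio α)
  obtain ⟨η, Y, hY, ⟨h⟩⟩ := hX fun x => φ (f x, c x)
  obtain ⟨x, hx, s, hsY, hne, hs⟩ := exists_seq_of_homeomorph_Iio_omega_add_one h
  refine hcL x ⟨s, hne, hs, fun k => ?_⟩
  have heq := Prod.ext_iff.1 (hφ ((hY (hsY k)).trans (hY hx).symm))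
  have := hcR (s k)
  rwa [show f (s k) = f x from heq.1, show c (s k) = c x from heq.2] at this

theorem mainTheorem1 {X : Type u} [TopologicalSpace X] [RegularSpace X]
    (hχ : character X < Cardinal.lift.{u} boundingNumber)
    (hX : TopArrow X (ω + 1 : Ordinal.{0}) ℕ) :
    ∀ α : Ordinal.{0}, α < ω₁ → TopArrow X α ℕ := by
  intro α hα f
  obtain ⟨n, x, hx⟩ := hX.exists_seqRank f hα
  obtain ⟨Y, hYA, -, -, hY⟩ := hx.exists_embedsIic hχ hα
  obtain ⟨K, hKY, hK⟩ := (hY Y self_mem_nhdsWithin).exists_homeomorph_Iio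
  exact ⟨n, K, hKY.trans hYA, hK⟩
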